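/- All Hilbert spaces are finite dimensional, $\|A\|_1=\operatorname{Tr}\sqrt{A^\dagger A}$ is the trace norm, and $F(\rho,\sigma)=\big(\operatorname{Tr}\sqrt{\sqrt\rho\,\sigma\sqrt\rho}\big)^2$ is the fidelity. For a unit vector $\psi$ the state $|\psi\rangle\langle\psi|$ is also denoted by $\psi$. A multipartite state is called PPT if its partial transpose with respect to every bipartition of the parties is positive semidefinite (for a single party there is no bipartition, and every state is PPT). A fully separable state is a convex combination of product pure states $\bigotimes_i|\phi_i\rangle\langle\phi_i|$. The geometric entanglement of a pure state is $E_G(\Psi)=1-\max_\phi|\langle\phi|\Psi\rangle|^2$, where $\phi$ ranges over the unit product vectors $\phi=\bigotimes_i\phi_i$. Let $M\ge 2$. (1) Let $\psi$ be an $M$-partite pure state and let $\sigma_{\mathrm{PPT}}$ be an $M$-partite PPT state with $F(\psi,\sigma_{\mathrm{PPT}})=1-\varepsilon$. Then there is a fully separable state $\sigma_{\mathrm{SEP}}$, which can be taken to be a pure product state, such that $$\|\sigma_{\mathrm{SEP}}-\psi\|_1\le(4M-6)\sqrt\varepsilon,\qquad \|\sigma_{\mathrm{PPT}}-\sigma_{\mathrm{SEP}}\|_1\le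 4(M-1)\sqrt\varepsilon,$$ and $|\operatorname{Tr}(\rho\,\sigma_{\mathrm{PPT}})-\operatorname{Tr}(\rho\,\sigma_{\mathrm{SEP}})|\le 4(M-1)\sqrt\varepsilon$ for every $M$-partite state $\rho$. (2) Let $\Psi$ be an $M$-partite pure state, let $B$ be one of the parties, and let $\rho=\operatorname{Tr}_B|\Psi\rangle\langle\Psi|$ be the reduced state of the other $M-1$ parties. Let $\sigma$ be an optimal state in $\max_{\sigma\in\mathrm{PPT}}\operatorname{Tr}(\rho\sigma)$, where $\mathrm{PPT}$ is the set of PPT states of these $M-1$ parties, and suppose that $F(\psi,\sigma)=1-\varepsilon$ for some pure state $\psi$ of these $M-1$ parties. Then $$1-\max_{\sigma'\in\mathrm{PPT}}\operatorname{Tr}(\rho\sigma')\;\le\;E_G(\Psi)\;\le\;1-\max_{\sigma'\in\mathrm{PPT}}\operatorname{Tr}(\rho\sigma')+4(M-2)\sqrt\varepsilon .$$ -/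

import Mathlib

/-! Finite-dimensional multipartite quantum systems.  Party `i : ι` has the Hilbert space
`ℂ^(d i)`; the joint Hilbert space, the tensor product of the local ones, is written in the product
basis, which is indexed by the tuples `∀ i, Fin (d i)`. -/

namespace Multipartite

open scoped ComplexOrder MatrixOrder Matrix

noncomputable section

/-- Labels of the product basis. -/
abbrev Config {ι : Type*} (d : ι → ℕ) : Type _ := ∀ i, Fin (d i)

/-- The joint Hilbert space `⨂ i, ℂ^(d i)`. -/
abbrev Space {ι : Type*} (d : ι → ℕ) : Type _ := EuclideanSpace ℂ (Config d)

/-- Operators on the joint Hilbert space. -/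
abbrev Op {ι : Type*} (d : ι → ℕ) : Type _ := Matrix (Config d) (Config d) ℂ

/-- The trace norm `‖A‖₁ = Tr √(A† A)`. -/
def traceNorm {n : Type*} [Fintype n] [DecidableEq n] (A : Matrix n n ℂ) : ℝ :=
  (CFC.sqrt (Aᴴ * A)).trace.re

/-- The fidelity `F(ρ, σ) = (Tr √(√ρ σ √ρ))²`. -/
def fidelity {n : Type*} [Fintype n] [DecidableEq n] (ρ σ : Matrix n n ℂ) : ℝ :=
  (CFC.sqrt (CFC.sqrt ρ * σ * CFC.sqrt ρ)).trace.re ^ 2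

/-- Quantum states: positive semidefinite operators of trace one. -/
def IsState {n : Type*} [Fintype n] (σ : Matrix n n ℂ) : Prop :=
  σ.PosSemidef ∧ σ.trace = 1

/-- The operator `|ψ⟩⟨ψ|`. -/
def pureDensity {n : Type*} (ψ : EuclideanSpace ℂ n) : Matrix n n ℂ :=
  Matrix.of fun x y => ψ x * star (ψ y)

section

variable {ι : Type*} [Fintype ι] [DecidableEq ι] {d : ι → ℕ}

/-- The product vector `⨂ i, φ i`. -/
def productVector (φ : ∀ i, EuclideanSpace ℂ (Fin (d i))) : Space d :=
  WithLp.toLp 2 fun x => ∏ i, φ i (x i)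

/-- Fully separable (product) pure state vectors: products of unit vectors of the parties. -/
def IsProductState (ψ : Space d) : Prop :=
  ∃ φ : ∀ i, EuclideanSpace ℂ (Fin (d i)), (∀ i, ‖φ i‖ = 1) ∧ ψ = productVector φ

/-- Fully separable states: convex combinations of fully separable pure states. -/
def IsFullySeparable (σ : Op d) : Prop :=
  σ ∈ convexHull ℝ {τ : Op d | ∃ φ : Space d, IsProductState φ ∧ τ = pureDensity φ}

/-- The partial transpose on the parties in `S`. -/
def partialTranspose (S : Finset ι) (σ : Op d) : Op d :=
  Matrix.of fun x y => σ (S.piecewise y x) (S.piecewise x y)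

/-- States with positive partial transpose with respect to every bipartition `S | Sᶜ`. -/
def IsPPT (σ : Op d) : Prop :=
  IsState σ ∧
    ∀ S : Finset ι, S.Nonempty → Sᶜ.Nonempty → (partialTranspose S σ).PosSemidef

/-- The partial trace over party `B`, an operator on the remaining parties. -/
def partialTrace (B : ι) (ρ : Op d) : Op (fun i : {i // i ≠ B} => d i) :=
  Matrix.of fun x y =>
    ∑ k : Fin (d B), ρ ((Equiv.piSplitAt B fun i => Fin (d i)).symm (k, x))
      ((Equiv.piSplitAt B fun i => Fin (d i)).symm (k, y))

/-- The geometric entanglement `E_G(ψ) = 1 - max |⟨φ|ψ⟩|²` of a pure state, the maximum being over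
all product states `φ`. -/
def geometricEntanglement (ψ : Space d) : ℝ :=
  1 - sSup {r : ℝ | ∃ φ : Space d, IsProductState φ ∧ r = ‖inner ℂ φ ψ‖ ^ 2}

/-- The estimate `1 - max_{σ ∈ PPT} Tr(ρ σ)`, where `ρ` is the reduced state of `ψ` on the parties
other than `B`. -/
def pptEstimate (B : ι) (ψ : Space d) : ℝ :=
  1 - sSup {r : ℝ | ∃ σ, IsPPT σ ∧ r = (partialTrace B (pureDensity ψ) * σ).trace.re}

/-- `σ` is an optimal PPT state in the maximization that defines `pptEstimate B ψ`. -/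
def IsOptimalPPT (B : ι) (ψ : Space d) (σ : Op (fun i : {i // i ≠ B} => d i)) : Prop :=
  IsPPT σ ∧ ∀ τ, IsPPT τ →
    (partialTrace B (pureDensity ψ) * τ).trace.re ≤ (partialTrace B (pureDensity ψ) * σ).trace.re

end

/-! The maxima in `geometricEntanglement` and `pptEstimate` are attained. -/

theorem continuous_pureDensity {n : Type*} :
    Continuous (pureDensity : EuclideanSpace ℂ n → Matrix n n ℂ) := by
  refine continuous_pi fun x => continuous_pi fun y => ?_
  simp only [pureDensity, Matrix.of_apply]
  fun_prop

theorem isCompact_isState {n : Type*} [Fintype n] :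
    IsCompact {σ : Matrix n n ℂ | IsState σ} := by
  classical
  have hK : IsCompact {B : n → n → ℂ | ∑ i, ∑ j, ‖B i j‖ ^ 2 = 1} := by
    refine Metric.isCompact_of_isClosed_isBounded
      (isClosed_eq (by fun_prop) continuous_const) ?_
    refine isBounded_iff_forall_norm_le.2 ⟨1, fun B hB => ?_⟩
    refine (pi_norm_le_iff_of_nonneg zero_le_one).2 fun i =>
      (pi_norm_le_iff_of_nonneg zero_le_one).2 fun j => ?_
    have h1 : ‖B i j‖ ^ 2 ≤ ∑ j, ‖B i j‖ ^ 2 :=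
      Finset.single_le_sum (f := fun j => ‖B i j‖ ^ 2) (fun _ _ => by positivity)
        (Finset.mem_univ j)
    have h2 : ∑ j, ‖B i j‖ ^ 2 ≤ ∑ i, ∑ j, ‖B i j‖ ^ 2 :=
      Finset.single_le_sum (f := fun i => ∑ j, ‖B i j‖ ^ 2) (fun _ _ => by positivity)
        (Finset.mem_univ i)
    rw [Set.mem_ofPred_eq] at hB
    nlinarith [norm_nonneg (B i j)]
  have htr : ∀ B : Matrix n n ℂ, (Bᴴ * B).trace = ((∑ i, ∑ j, ‖B i j‖ ^ 2 : ℝ) : ℂ) := by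
    intro B
    rw [Finset.sum_comm]
    simp [Matrix.trace, Matrix.mul_apply, Complex.conj_mul']
  have himg : {σ : Matrix n n ℂ | IsState σ} =
      (fun B : Matrix n n ℂ => Bᴴ * B) '' {B | ∑ i, ∑ j, ‖B i j‖ ^ 2 = 1} := by
    ext σ
    constructor
    · rintro ⟨h1, h2⟩
      obtain ⟨B, rfl⟩ := CStarAlgebra.nonneg_iff_eq_star_mul_self.mp h1.nonneg
      refine ⟨B, ?_, rfl⟩
      rw [Matrix.star_eq_conjTranspose, htr] at h2
      exact_mod_cast h2
    · rintro ⟨B, hB, rfl⟩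
      refine ⟨Matrix.posSemidef_conjTranspose_mul_self B, ?_⟩
      rw [Set.mem_ofPred_eq] at hB
      rw [htr, hB, Complex.ofReal_one]
  rw [himg]
  exact hK.image (f := fun B : Matrix n n ℂ => Bᴴ * B)
    (Continuous.matrix_mul (Continuous.matrix_conjTranspose continuous_id) continuous_id)

theorem isClosed_posSemidef {n : Type*} [Fintype n] :
    IsClosed {σ : Matrix n n ℂ | σ.PosSemidef} := by
  simp only [Matrix.posSemidef_iff_dotProduct_mulVec, Set.ofPred_and, Set.ofPred_forall]
  refine IsClosed.inter
    (isClosed_eq (Continuous.matrix_conjTranspose continuous_id) continuous_id)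
    (isClosed_iInter fun x => ?_)
  exact isClosed_Ici.preimage (f := fun σ : Matrix n n ℂ => star x ⬝ᵥ σ.mulVec x)
    (Continuous.dotProduct continuous_const
      (Continuous.matrix_mulVec continuous_id continuous_const))

theorem isCompact_isPPT {ι : Type*} [Fintype ι] [DecidableEq ι] {d : ι → ℕ} :
    IsCompact {σ : Op d | IsPPT σ} := by
  refine isCompact_isState.inter_right (t := {σ : Op d | ∀ S : Finset ι, S.Nonempty →
    Sᶜ.Nonempty → (partialTranspose S σ).PosSemidef}) ?_
  simp only [Set.ofPred_forall]
  refine isClosed_iInter fun S => isClosed_iInter fun _ => isClosed_iInter fun _ => ?_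
  refine isClosed_posSemidef.preimage (f := fun σ : Op d => partialTranspose S σ) ?_
  refine continuous_pi fun x => continuous_pi fun y => ?_
  exact continuous_apply_apply (S.piecewise y x) (S.piecewise x y)

theorem exists_isPPT {ι : Type*} [Fintype ι] [DecidableEq ι] {d : ι → ℕ} (x : Config d) :
    ∃ σ : Op d, IsPPT σ := by
  have hpsd : (Matrix.diagonal (Pi.single x 1) : Op d).PosSemidef :=
    Matrix.PosSemidef.diagonal (Pi.single_nonneg.2 zero_le_one)
  refine ⟨Matrix.diagonal (Pi.single x 1), ⟨hpsd, by simp [Matrix.trace_diagonal]⟩,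
    fun S _ _ => ?_⟩
  convert hpsd using 1
  ext a b
  rw [partialTranspose, Matrix.of_apply, Matrix.diagonal_apply, Matrix.diagonal_apply]
  by_cases h : a = b
  · subst h; simp [Finset.piecewise_same]
  · rw [if_neg h, if_neg]
    intro h'
    refine h (funext fun i => ?_)
    have := congrFun h' i
    by_cases hi : i ∈ S <;> simp [hi] at this <;> simp [this]

theorem exists_isOptimalPPT {ι : Type*} [Fintype ι] [DecidableEq ι] {d : ι → ℕ} (B : ι)
    (ψ : Space d) (hψ : ψ ≠ 0) :
    ∃ σ, IsOptimalPPT B ψ σ ∧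
      pptEstimate B ψ = 1 - (partialTrace B (pureDensity ψ) * σ).trace.re := by
  obtain ⟨x⟩ : Nonempty (Config d) := by
    by_contra h
    rw [not_nonempty_iff] at h
    exact hψ (Subsingleton.elim _ _)
  obtain ⟨σ, h1, h2⟩ := (isCompact_isPPT (d := fun i : {i // i ≠ B} => d i)).exists_isMaxOn
    (exists_isPPT fun i => x i)
    (f := fun τ => (partialTrace B (pureDensity ψ) * τ).trace.re)
    (Continuous.continuousOn (Complex.continuous_re.comp
      (Continuous.matrix_trace (Continuous.matrix_mul continuous_const continuous_id))))
  have hle : ∀ τ, IsPPT τ → (partialTrace B (pureDensity ψ) * τ).trace.re ≤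
      (partialTrace B (pureDensity ψ) * σ).trace.re := fun τ hτ => h2 hτ
  refine ⟨σ, ⟨h1, hle⟩, ?_⟩
  rw [pptEstimate, IsGreatest.csSup_eq (a := (partialTrace B (pureDensity ψ) * σ).trace.re)]
  refine ⟨⟨σ, h1, rfl⟩, ?_⟩
  rintro r ⟨τ, hτ, rfl⟩
  exact hle τ hτ

theorem exists_geometricEntanglement_eq {ι : Type*} [Fintype ι] [DecidableEq ι] {d : ι → ℕ}
    (ψ : Space d) (hψ : ψ ≠ 0) :
    ∃ φ : Space d, IsProductState φ ∧ geometricEntanglement ψ = 1 - ‖inner ℂ φ ψ‖ ^ 2 := by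
  obtain ⟨x⟩ : Nonempty (Config d) := by
    by_contra h
    rw [not_nonempty_iff] at h
    exact hψ (Subsingleton.elim _ _)
  have hc : Continuous fun φ : ∀ i, EuclideanSpace ℂ (Fin (d i)) =>
      ‖inner ℂ (productVector φ) ψ‖ ^ 2 := by
    have : Continuous (productVector (d := d)) := by
      unfold productVector
      fun_prop
    fun_prop
  obtain ⟨φ, h1, h2⟩ := (isCompact_univ_pi fun i =>
    isCompact_sphere (0 : EuclideanSpace ℂ (Fin (d i))) 1).exists_isMaxOn
    ⟨fun i => EuclideanSpace.single (x i) 1, by simp⟩ hc.continuousOn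
  refine ⟨productVector φ, ⟨φ, fun i => by simpa using h1 i (Set.mem_univ i), rfl⟩, ?_⟩
  rw [geometricEntanglement, IsGreatest.csSup_eq (a := ‖inner ℂ (productVector φ) ψ‖ ^ 2)]
  refine ⟨⟨_, ⟨φ, fun i => by simpa using h1 i (Set.mem_univ i), rfl⟩, rfl⟩, ?_⟩
  rintro r ⟨_, ⟨χ, hχ, rfl⟩, rfl⟩
  exact h2 (a := χ) (by simpa using hχ)

end

end Multipartite

open Multipartite

namespace Multipartite

open scoped ComplexOrder MatrixOrder Matrix
open Matrix

/-! ### Trace norm, fidelity with a pure state, and the Fuchs–van de Graaf bound. -/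

section TraceNorm

variable {n : Type*} [Fintype n]

/-! For pure `ψ` the fidelity is `⟨ψ|σ|ψ⟩` (`fidelity_pureDensity`). Across a cut `i | rest`,
partial transposition on both factors preserves the trace of a product, so `⟨ψ|σ|ψ⟩ = Tr(σ^Γ ψ^Γ)`.
Here `σ^Γ ≥ 0` has trace one and `ψ^Γ ≤ λ·1`, with `λ` the largest squared Schmidt coefficient of
`ψ`. Hence each party `i` has a unit vector `u i` whose local projection has expectation at least `1
- ε` in `ψ` (`IsPPT.exists_unit_re_le`). Only the cuts that isolate one party are needed.

The local projections commute, so a union bound over all parties but one, `B`, shows that their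
product has expectation at least `1 - (M-1)ε`. This expectation is the squared norm of the vector
left at `B` after contracting `ψ` with the `u i`; taking its direction as the vector of party `B`
gives a product state `φ` with `1 - |⟨φ|ψ⟩|² ≤ (M-1)ε` (`IsPPT.exists_isProductState_overlap`). The
Fuchs–van de Graaf inequality, the triangle inequality and the duality `|Tr(ρA)| ≤ ‖A‖₁` turn this
into part (1).

For part (2), maximizing `|⟨φ|Ψ⟩|²` over the vector of `B` leaves `⟨w|ρ|w⟩`, with `w` the product of
the other vectors. Thus `1 - E_G` is the maximum of `Tr(ρσ')` over product states `σ'`. Product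
states are PPT, which gives the lower bound. Replacing the optimal `σ` by the product state of part
(1) for `M-1` parties gives the upper bound, while for a single remaining party a top eigenvector of
`ρ` suffices. -/

theorem star_dotProduct_self (v : n → ℂ) : star v ⬝ᵥ v = ((∑ i, ‖v i‖ ^ 2 : ℝ) : ℂ) := by
  simp [dotProduct, Complex.conj_mul']

theorem sum_norm_sq_eq_one {ψ : EuclideanSpace ℂ n} (hψ : ‖ψ‖ = 1) : ∑ i, ‖ψ i‖ ^ 2 = 1 := by
  rw [← EuclideanSpace.norm_sq_eq, hψ, one_pow]

omit [Fintype n] in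
theorem pureDensity_eq_vecMulVec (ψ : EuclideanSpace ℂ n) :
    pureDensity ψ = vecMulVec ψ.ofLp (star ψ.ofLp) := rfl

theorem trace_mul_vecMulVec_star (A : Matrix n n ℂ) (x : n → ℂ) :
    (A * vecMulVec x (star x)).trace = star x ⬝ᵥ A *ᵥ x := by
  rw [mul_vecMulVec, trace_vecMulVec, dotProduct_comm]

theorem trace_mul_pureDensity (A : Matrix n n ℂ) (ψ : EuclideanSpace ℂ n) :
    (A * pureDensity ψ).trace = star ψ.ofLp ⬝ᵥ A *ᵥ ψ.ofLp :=
  trace_mul_vecMulVec_star A _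

theorem isState_pureDensity {ψ : EuclideanSpace ℂ n} (hψ : ‖ψ‖ = 1) :
    IsState (pureDensity ψ) := by
  refine ⟨posSemidef_vecMulVec_self_star _, ?_⟩
  rw [pureDensity_eq_vecMulVec, trace_vecMulVec, dotProduct_comm, star_dotProduct_self,
    sum_norm_sq_eq_one hψ, Complex.ofReal_one]

theorem exists_conjTranspose_mul_self {X : Matrix n n ℂ} (hX : X.PosSemidef) :
    ∃ C : Matrix n n ℂ, X = Cᴴ * C := by
  classical
  obtain ⟨C, rfl⟩ := CStarAlgebra.nonneg_iff_eq_star_mul_self.mp hX.nonneg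
  exact ⟨C, rfl⟩

theorem star_dotProduct_conjTranspose_mul_mulVec {m : Type*} [Fintype m] (C : Matrix m n ℂ)
    (x : n → ℂ) : star x ⬝ᵥ (Cᴴ * C) *ᵥ x = ((∑ i, ‖(C *ᵥ x) i‖ ^ 2 : ℝ) : ℂ) := by
  rw [← star_dotProduct_self, ← mulVec_mulVec, dotProduct_mulVec, star_mulVec]

theorem re_trace_mul_nonneg {X Y : Matrix n n ℂ} (hX : X.PosSemidef) (hY : Y.PosSemidef) :
    0 ≤ (X * Y).trace.re := by
  obtain ⟨C, rfl⟩ := exists_conjTranspose_mul_self hX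
  rw [mul_assoc, trace_mul_comm]
  exact (Complex.nonneg_iff.1 (hY.mul_mul_conjTranspose_same C).trace_nonneg).1

theorem re_trace_mul_le [DecidableEq n] {X Y : Matrix n n ℂ} (hX : X.PosSemidef) {c : ℝ}
    (hY : ((c : ℂ) • (1 : Matrix n n ℂ) - Y).PosSemidef) :
    (X * Y).trace.re ≤ c * X.trace.re := by
  have := re_trace_mul_nonneg hX hY
  rw [mul_sub, trace_sub, mul_smul_comm, mul_one, trace_smul, Complex.sub_re, smul_eq_mul,
    Complex.re_ofReal_mul] at this
  linarith

theorem norm_sq_mulVec_le {m : Type*} (C : Matrix m n ℂ) (x : n → ℂ) (i : m) :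
    ‖(C *ᵥ x) i‖ ^ 2 ≤ (∑ j, ‖C i j‖ ^ 2) * ∑ j, ‖x j‖ ^ 2 := by
  refine le_trans ?_ (Finset.sum_mul_sq_le_sq_mul_sq Finset.univ (fun j => ‖C i j‖) fun j => ‖x j‖)
  refine pow_le_pow_left₀ (norm_nonneg _) ((norm_sum_le _ _).trans_eq ?_) 2
  simp

/-- For `X = C†C` the trace is the squared Hilbert–Schmidt norm of `C`, and Cauchy–Schwarz applies
to each row of `C`. -/
theorem re_star_dotProduct_mulVec_le {X : Matrix n n ℂ} (hX : X.PosSemidef) (x : n → ℂ) :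
    (star x ⬝ᵥ X *ᵥ x).re ≤ X.trace.re * ∑ j, ‖x j‖ ^ 2 := by
  obtain ⟨C, rfl⟩ := exists_conjTranspose_mul_self hX
  have htr : (Cᴴ * C).trace = ((∑ i, ∑ j, ‖C i j‖ ^ 2 : ℝ) : ℂ) := by
    rw [Finset.sum_comm]
    simp [Matrix.trace, Matrix.mul_apply, Complex.conj_mul']
  rw [star_dotProduct_conjTranspose_mul_mulVec, htr, Complex.ofReal_re, Complex.ofReal_re,
    Finset.sum_mul]
  exact Finset.sum_le_sum fun i _ => norm_sq_mulVec_le C x i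

theorem re_star_dotProduct_mulVec_nonneg {X : Matrix n n ℂ} (hX : X.PosSemidef) (x : n → ℂ) :
    0 ≤ (star x ⬝ᵥ X *ᵥ x).re :=
  (Complex.nonneg_iff.1 (hX.dotProduct_mulVec_nonneg x)).1

theorem ofReal_re_star_dotProduct_mulVec {X : Matrix n n ℂ} (hX : X.PosSemidef) (x : n → ℂ) :
    (((star x ⬝ᵥ X *ᵥ x).re : ℝ) : ℂ) = star x ⬝ᵥ X *ᵥ x :=
  Complex.ext rfl (Complex.nonneg_iff.1 (hX.dotProduct_mulVec_nonneg x)).2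

theorem IsState.re_star_dotProduct_mulVec_le_one {σ : Matrix n n ℂ} (hσ : IsState σ)
    {x : n → ℂ} (hx : ∑ j, ‖x j‖ ^ 2 = 1) : (star x ⬝ᵥ σ *ᵥ x).re ≤ 1 := by
  simpa [hσ.2, hx] using re_star_dotProduct_mulVec_le hσ.1 x

/-- The seminorm of a positive semidefinite form satisfies the triangle inequality. -/
theorem sqrt_re_star_dotProduct_mulVec_add_le {X : Matrix n n ℂ} (hX : X.PosSemidef)
    (x y : n → ℂ) :
    √(star (x + y) ⬝ᵥ X *ᵥ (x + y)).re ≤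
      √(star x ⬝ᵥ X *ᵥ x).re + √(star y ⬝ᵥ X *ᵥ y).re := by
  obtain ⟨C, rfl⟩ := exists_conjTranspose_mul_self hX
  have h : ∀ z : n → ℂ, √(star z ⬝ᵥ (Cᴴ * C) *ᵥ z).re = ‖WithLp.toLp 2 (C *ᵥ z)‖ := by
    intro z
    rw [star_dotProduct_conjTranspose_mul_mulVec, Complex.ofReal_re, EuclideanSpace.norm_eq]
  rw [h, h, h, mulVec_add, WithLp.toLp_add]
  exact norm_add_le _ _

variable [DecidableEq n]

theorem exists_eq_unitary_conj_diagonal {A : Matrix n n ℂ} (hA : A.IsHermitian) :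
    ∃ (W : Matrix n n ℂ) (l : n → ℝ), W * Wᴴ = 1 ∧ Wᴴ * W = 1 ∧
      A = W * diagonal (fun i => (l i : ℂ)) * Wᴴ := by
  refine ⟨hA.eigenvectorUnitary, hA.eigenvalues, ?_, ?_, ?_⟩
  · exact (Matrix.mem_unitaryGroup_iff).1 hA.eigenvectorUnitary.2
  · exact (Matrix.mem_unitaryGroup_iff').1 hA.eigenvectorUnitary.2
  · exact hA.spectral_theorem

theorem traceNorm_unitary_conj_diagonal {W : Matrix n n ℂ} (hW : Wᴴ * W = 1) (l : n → ℝ) :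
    traceNorm (W * diagonal (fun i => (l i : ℂ)) * Wᴴ) = ∑ i, |l i| := by
  have hmul : ∀ f g : n → ℂ, (W * diagonal f * Wᴴ) * (W * diagonal g * Wᴴ) =
      W * diagonal (fun i => f i * g i) * Wᴴ := by
    intro f g
    calc _ = W * diagonal f * (Wᴴ * W) * diagonal g * Wᴴ := by simp only [mul_assoc]
      _ = _ := by rw [hW, mul_one, mul_assoc W, diagonal_mul_diagonal]
  have hsqrt : CFC.sqrt ((W * diagonal (fun i => (l i : ℂ)) * Wᴴ)ᴴ *
      (W * diagonal (fun i => (l i : ℂ)) * Wᴴ)) =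
      W * diagonal (fun i => ((|l i| : ℝ) : ℂ)) * Wᴴ := by
    refine CFC.sqrt_unique ?_ ?_
    · have : (W * diagonal (fun i => (l i : ℂ)) * Wᴴ)ᴴ =
          W * diagonal (fun i => (l i : ℂ)) * Wᴴ := by
        rw [conjTranspose_mul, conjTranspose_mul, conjTranspose_conjTranspose,
          diagonal_conjTranspose, ← mul_assoc]
        congr 3
        ext i
        simp
      rw [this, hmul, hmul]
      congr 3
      ext i
      rw [← Complex.ofReal_mul, abs_mul_abs_self, Complex.ofReal_mul]
    · refine ((PosSemidef.diagonal fun i => ?_).mul_mul_conjTranspose_same W).nonneg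
      simp
  rw [traceNorm, hsqrt, trace_mul_comm, ← mul_assoc, hW, one_mul, trace_diagonal,
    ← Complex.ofReal_sum, Complex.ofReal_re]

/-- `P` is the spectral projection onto the nonnegative eigenvalues, so `2P - 1` is the sign of `A`.
This turns the trace norm into the statistics of a two-outcome measurement. -/
theorem exists_projection_traceNorm_eq {A : Matrix n n ℂ} (hA : A.IsHermitian) :
    ∃ P : Matrix n n ℂ, Pᴴ = P ∧ P * P = P ∧
      traceNorm A = 2 * (P * A).trace.re - A.trace.re := by
  obtain ⟨W, l, -, hW, rfl⟩ := exists_eq_unitary_conj_diagonal hA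
  have hmul : ∀ f g : n → ℂ, (W * diagonal f * Wᴴ) * (W * diagonal g * Wᴴ) =
      W * diagonal (fun i => f i * g i) * Wᴴ := by
    intro f g
    calc _ = W * diagonal f * (Wᴴ * W) * diagonal g * Wᴴ := by simp only [mul_assoc]
      _ = _ := by rw [hW, mul_one, mul_assoc W, diagonal_mul_diagonal]
  have htr : ∀ f : n → ℂ, (W * diagonal f * Wᴴ).trace = ∑ i, f i := by
    intro f
    rw [trace_mul_comm, ← mul_assoc, hW, one_mul, trace_diagonal]
  refine ⟨W * diagonal (fun i => if 0 ≤ l i then 1 else 0) * Wᴴ, ?_, ?_, ?_⟩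
  · rw [conjTranspose_mul, conjTranspose_mul, conjTranspose_conjTranspose,
      diagonal_conjTranspose, ← mul_assoc]
    congr 3
    ext i
    by_cases h : 0 ≤ l i <;> simp [h]
  · rw [hmul]
    congr 3
    ext i
    by_cases h : 0 ≤ l i <;> simp [h]
  · rw [traceNorm_unitary_conj_diagonal hW, hmul, htr, htr, Complex.re_sum, Complex.re_sum,
      Finset.mul_sum, ← Finset.sum_sub_distrib]
    refine Finset.sum_congr rfl fun i _ => ?_
    by_cases h : 0 ≤ l i
    · simp [h, abs_of_nonneg h]; ring
    · simp [h, abs_of_neg (not_le.1 h)]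

/-- In an eigenbasis of `A` the trace is the sum of the eigenvalues weighted by diagonal entries of
`U`. A bound on the numerical range of `U` is therefore enough, and it covers both states and `2P -
1`. -/
theorem norm_trace_mul_le_traceNorm {A U : Matrix n n ℂ} (hA : A.IsHermitian)
    (hU : ∀ x : n → ℂ, ∑ j, ‖x j‖ ^ 2 = 1 → ‖star x ⬝ᵥ U *ᵥ x‖ ≤ 1) :
    ‖(U * A).trace‖ ≤ traceNorm A := by
  obtain ⟨W, l, -, hW, rfl⟩ := exists_eq_unitary_conj_diagonal hA
  have h1 : (U * (W * diagonal (fun i => (l i : ℂ)) * Wᴴ)).trace =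
      ∑ i, (Wᴴ * U * W) i i * l i := by
    rw [← mul_assoc, trace_mul_comm, ← mul_assoc, ← mul_assoc, Matrix.trace]
    simp [mul_diagonal]
  have h2 : ∀ i, (Wᴴ * U * W) i i = star (W.col i) ⬝ᵥ U *ᵥ W.col i := by
    intro i
    rw [mul_assoc]
    simp [Matrix.mul_apply, dotProduct, mulVec]
  rw [traceNorm_unitary_conj_diagonal hW, h1]
  refine (norm_sum_le _ _).trans (Finset.sum_le_sum fun i _ => ?_)
  rw [norm_mul, Complex.norm_real, Real.norm_eq_abs, h2]
  refine mul_le_of_le_one_left (abs_nonneg _) (hU _ ?_)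
  have : star (W.col i) ⬝ᵥ W.col i = 1 := by
    have := congrFun (congrFun hW i) i
    simpa [Matrix.mul_apply, dotProduct] using this
  rw [star_dotProduct_self] at this
  exact_mod_cast this

theorem IsState.norm_trace_mul_le_traceNorm {A ρ : Matrix n n ℂ} (hA : A.IsHermitian)
    (hρ : IsState ρ) : ‖(ρ * A).trace‖ ≤ traceNorm A := by
  refine Multipartite.norm_trace_mul_le_traceNorm hA fun x hx => ?_
  rw [← ofReal_re_star_dotProduct_mulVec hρ.1, Complex.norm_real, Real.norm_eq_abs,
    abs_of_nonneg (re_star_dotProduct_mulVec_nonneg hρ.1 x)]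
  exact hρ.re_star_dotProduct_mulVec_le_one hx

omit [DecidableEq n] in
theorem posSemidef_of_projection {P : Matrix n n ℂ} (h1 : Pᴴ = P) (h2 : P * P = P) :
    P.PosSemidef := by
  have := posSemidef_conjTranspose_mul_self P
  rwa [h1, h2] at this

theorem projection_one_sub {P : Matrix n n ℂ} (h1 : Pᴴ = P) (h2 : P * P = P) :
    (1 - P)ᴴ = 1 - P ∧ (1 - P) * (1 - P) = 1 - P := by
  refine ⟨by rw [conjTranspose_sub, conjTranspose_one, h1], ?_⟩
  rw [mul_sub, mul_one, sub_mul, one_mul, h2, sub_self, sub_zero]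

theorem traceNorm_add_le {A B : Matrix n n ℂ} (hA : A.IsHermitian) (hB : B.IsHermitian) :
    traceNorm (A + B) ≤ traceNorm A + traceNorm B := by
  obtain ⟨P, h1, h2, h⟩ := exists_projection_traceNorm_eq (hA.add hB)
  -- `2P - 1`, with `P` optimal for `A + B`, is an admissible but possibly suboptimal test operator
  -- for `A` and for `B`.
  have hU : ∀ x : n → ℂ, ∑ j, ‖x j‖ ^ 2 = 1 →
      ‖star x ⬝ᵥ ((2 : ℂ) • P - 1) *ᵥ x‖ ≤ 1 := by
    intro x hx
    have hP := posSemidef_of_projection h1 h2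
    have hP' := posSemidef_of_projection (projection_one_sub h1 h2).1 (projection_one_sub h1 h2).2
    have hx' : star x ⬝ᵥ x = 1 := by rw [star_dotProduct_self, hx, Complex.ofReal_one]
    have e1 := re_star_dotProduct_mulVec_nonneg hP x
    have e2 := re_star_dotProduct_mulVec_nonneg hP' x
    rw [sub_mulVec, one_mulVec, dotProduct_sub, hx', Complex.sub_re, Complex.one_re] at e2
    rw [sub_mulVec, one_mulVec, dotProduct_sub, hx', smul_mulVec, dotProduct_smul,
      ← ofReal_re_star_dotProduct_mulVec hP, smul_eq_mul]
    rw [show (2 : ℂ) * (((star x ⬝ᵥ P *ᵥ x).re : ℝ) : ℂ) - 1 =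
      ((2 * (star x ⬝ᵥ P *ᵥ x).re - 1 : ℝ) : ℂ) by push_cast; rfl, Complex.norm_real,
      Real.norm_eq_abs, abs_le]
    constructor <;> linarith
  have hb : ∀ C : Matrix n n ℂ, C.IsHermitian →
      2 * (P * C).trace.re - C.trace.re ≤ traceNorm C := by
    intro C hC
    have := (Complex.re_le_norm _).trans (norm_trace_mul_le_traceNorm hC hU)
    simpa [sub_mul] using this
  have := hb A hA
  have := hb B hB
  rw [h, mul_add, trace_add, trace_add, Complex.add_re, Complex.add_re]
  linarith

/-- Fuchs–van de Graaf for the distributions `(p, 1-p)` and `(q, 1-q)`. With `a² = p(1-q)` and `b² =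
(1-p)q` one has `p - q = (a-b)(a+b)`, where `(a+b)² ≤ 1` and `(a-b)² ≤ 1 - f`. -/
theorem abs_sub_le_sqrt_of_le_sq {p q f : ℝ} (hp : 0 ≤ p) (hp1 : p ≤ 1) (hq : 0 ≤ q) (hq1 : q ≤ 1)
    (hf : √f ≤ √(p * q) + √((1 - p) * (1 - q))) (hf0 : 0 ≤ f) : |p - q| ≤ √(1 - f) := by
  refine Real.abs_le_sqrt ?_
  have hf' : f ≤ (√(p * q) + √((1 - p) * (1 - q))) ^ 2 :=
    (Real.sq_sqrt hf0).symm.le.trans (pow_le_pow_left₀ (Real.sqrt_nonneg _) hf 2)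
  have e1 := Real.sq_sqrt (mul_nonneg hp hq)
  have e2 := Real.sq_sqrt (mul_nonneg (sub_nonneg.2 hp1) (sub_nonneg.2 hq1))
  have e3 := Real.sq_sqrt (mul_nonneg hp (sub_nonneg.2 hq1))
  have e4 := Real.sq_sqrt (mul_nonneg (sub_nonneg.2 hp1) hq)
  have e5 : √(p * q) * √((1 - p) * (1 - q)) = √(p * (1 - q)) * √((1 - p) * q) := by
    rw [← Real.sqrt_mul (mul_nonneg hp hq), ← Real.sqrt_mul (mul_nonneg hp (sub_nonneg.2 hq1))]
    congr 1
    ring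
  set a := √(p * (1 - q))
  set b := √((1 - p) * q)
  have e6 : p - q = a ^ 2 - b ^ 2 := by rw [e3, e4]; ring
  have e7 : f ≤ 1 - (a - b) ^ 2 := by nlinarith
  have e8 : (a + b) ^ 2 ≤ 1 := by nlinarith [sq_nonneg (√(p * q) - √((1 - p) * (1 - q)))]
  rw [e6]
  nlinarith [mul_le_mul_of_nonneg_left e8 (sq_nonneg (a - b))]

/-- Fuchs–van de Graaf inequality for a pure state. -/
theorem traceNorm_sub_pureDensity_le {σ : Matrix n n ℂ} (hσ : IsState σ)
    {ψ : EuclideanSpace ℂ n} (hψ : ‖ψ‖ = 1) :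
    traceNorm (σ - pureDensity ψ) ≤ 2 * √(1 - (star ψ.ofLp ⬝ᵥ σ *ᵥ ψ.ofLp).re) := by
  have hψs := isState_pureDensity hψ
  obtain ⟨P, h1, h2, h⟩ := exists_projection_traceNorm_eq (hσ.1.1.sub hψs.1.1)
  set x := ψ.ofLp with hx
  have hx1 : ∑ i, ‖x i‖ ^ 2 = 1 := sum_norm_sq_eq_one hψ
  obtain ⟨h3, h4⟩ := projection_one_sub h1 h2
  -- The operator norm of `QσQ` is at most its trace `Tr(Qσ)`; evaluate its form at `Qx`.
  have key : ∀ Q : Matrix n n ℂ, Qᴴ = Q → Q * Q = Q →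
      (star (Q *ᵥ x) ⬝ᵥ σ *ᵥ (Q *ᵥ x)).re ≤ (Q * σ).trace.re * (star x ⬝ᵥ Q *ᵥ x).re := by
    intro Q q1 q2
    have e := re_star_dotProduct_mulVec_le (hσ.1.mul_mul_conjTranspose_same Q) (Q *ᵥ x)
    have e1 : star (Q *ᵥ x) ⬝ᵥ (Q * σ * Qᴴ) *ᵥ (Q *ᵥ x) = star (Q *ᵥ x) ⬝ᵥ σ *ᵥ (Q *ᵥ x) := by
      rw [q1, mulVec_mulVec, mul_assoc, q2, mul_assoc, ← mulVec_mulVec, dotProduct_mulVec,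
        star_mulVec, q1, vecMul_vecMul, q2, mulVec_mulVec]
    have e2 : (Q * σ * Qᴴ).trace = (Q * σ).trace := by
      rw [trace_mul_comm, q1, ← mul_assoc, q2]
    have e3 : star x ⬝ᵥ Q *ᵥ x = ((∑ i, ‖(Q *ᵥ x) i‖ ^ 2 : ℝ) : ℂ) := by
      rw [← star_dotProduct_conjTranspose_mul_mulVec, q1, q2]
    rwa [e1, e2, ← Complex.ofReal_re (∑ i, ‖(Q *ᵥ x) i‖ ^ 2), ← e3] at e
  have hP := posSemidef_of_projection h1 h2
  have hP' := posSemidef_of_projection h3 h4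
  have k1 := key P h1 h2
  have k2 := key (1 - P) h3 h4
  have t1 := re_trace_mul_nonneg hP hσ.1
  have t2 := re_trace_mul_nonneg hP' hσ.1
  have q1 := re_star_dotProduct_mulVec_nonneg hP x
  have q2 := re_star_dotProduct_mulVec_nonneg hP' x
  have et : ((1 - P) * σ).trace.re = 1 - (P * σ).trace.re := by
    simp [sub_mul, hσ.2]
  have eq : (star x ⬝ᵥ (1 - P) *ᵥ x).re = 1 - (star x ⬝ᵥ P *ᵥ x).re := by
    rw [sub_mulVec, one_mulVec, dotProduct_sub, star_dotProduct_self, hx1]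
    simp
  rw [et, eq] at k2
  rw [et] at t2
  rw [eq] at q2
  -- Splitting `x = Px + (1-P)x` in the seminorm of `σ` bounds the root of the fidelity by the
  -- classical one of the measurement `{P, 1-P}`.
  have tri := sqrt_re_star_dotProduct_mulVec_add_le hσ.1 (P *ᵥ x) ((1 - P) *ᵥ x)
  rw [← add_mulVec, add_sub_cancel, one_mulVec] at tri
  have habs := abs_sub_le_sqrt_of_le_sq t1 (sub_nonneg.1 t2) q1 (sub_nonneg.1 q2)
    (tri.trans (add_le_add (Real.sqrt_le_sqrt k1) (Real.sqrt_le_sqrt k2)))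
    (re_star_dotProduct_mulVec_nonneg hσ.1 x)
  rw [h, mul_sub, trace_sub, trace_sub, trace_mul_pureDensity, hσ.2, hψs.2, sub_self,
    Complex.zero_re, sub_zero, Complex.sub_re]
  exact mul_le_mul_of_nonneg_left ((le_abs_self _).trans habs) zero_le_two

/-- The rank-one projection `ψ` is its own square root, and `ψσψ` is the multiple `⟨ψ|σ|ψ⟩` of `ψ`.
-/
theorem fidelity_pureDensity {σ : Matrix n n ℂ} (hσ : σ.PosSemidef)
    {ψ : EuclideanSpace ℂ n} (hψ : ‖ψ‖ = 1) :
    fidelity (pureDensity ψ) σ = (star ψ.ofLp ⬝ᵥ σ *ᵥ ψ.ofLp).re := by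
  have hψs := isState_pureDensity hψ
  have hnn : ∀ c : ℝ, 0 ≤ c → 0 ≤ (c : ℂ) • pureDensity ψ := fun c hc =>
    (hψs.1.smul (Complex.zero_le_real.2 hc)).nonneg
  have hself : star ψ.ofLp ⬝ᵥ ψ.ofLp = 1 := by
    rw [star_dotProduct_self, sum_norm_sq_eq_one hψ, Complex.ofReal_one]
  have hidem : pureDensity ψ * pureDensity ψ = pureDensity ψ := by
    rw [pureDensity_eq_vecMulVec, vecMulVec_mul_vecMulVec, hself, one_smul]
  have hs1 : CFC.sqrt (pureDensity ψ) = pureDensity ψ :=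
    CFC.sqrt_unique hidem hψs.1.nonneg
  have hf := re_star_dotProduct_mulVec_nonneg hσ ψ.ofLp
  set f := (star ψ.ofLp ⬝ᵥ σ *ᵥ ψ.ofLp).re with hfdef
  have hmid : pureDensity ψ * σ * pureDensity ψ = (f : ℂ) • pureDensity ψ := by
    rw [hfdef, ofReal_re_star_dotProduct_mulVec hσ, pureDensity_eq_vecMulVec, mul_assoc,
      mul_vecMulVec, vecMulVec_mul_vecMulVec, vecMulVec_smul]
  have hs2 : CFC.sqrt ((f : ℂ) • pureDensity ψ) = ((√f : ℝ) : ℂ) • pureDensity ψ := by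
    refine CFC.sqrt_unique ?_ (hnn _ (Real.sqrt_nonneg _))
    rw [smul_mul_smul_comm, hidem, ← Complex.ofReal_mul, Real.mul_self_sqrt hf]
  rw [fidelity, hs1, hmid, hs2, trace_smul, hψs.2, smul_eq_mul, mul_one, Complex.ofReal_re,
    Real.sq_sqrt hf]

end TraceNorm

/-! ### Partial transposes and Schmidt coefficients across one cut. -/

section Bipartite

variable {a b : Type*} [Fintype a] [Fintype b]

/-- The maximum exists by compactness of the sphere and extends to all `v` by homogeneity. Its value
is the largest squared singular value of `Ψ`, that is, the largest squared Schmidt coefficient when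
`Ψ` is a bipartite vector. -/
theorem exists_unit_isMax_vecMul [Nonempty a] (Ψ : Matrix a b ℂ) :
    ∃ u : EuclideanSpace ℂ a, ‖u‖ = 1 ∧ ∀ v : a → ℂ,
      ∑ j, ‖(star v ᵥ* Ψ) j‖ ^ 2 ≤ (∑ j, ‖(star u.ofLp ᵥ* Ψ) j‖ ^ 2) * ∑ i, ‖v i‖ ^ 2 := by
  classical
  have hc : Continuous fun u : EuclideanSpace ℂ a => ∑ j, ‖(star u.ofLp ᵥ* Ψ) j‖ ^ 2 := by
    simp only [vecMul, dotProduct, Pi.star_apply]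
    fun_prop
  obtain ⟨u, h1, h2⟩ := (isCompact_sphere (0 : EuclideanSpace ℂ a) 1).exists_isMaxOn
    ⟨EuclideanSpace.single (Classical.arbitrary a) 1, by simp⟩ hc.continuousOn
  refine ⟨u, by simpa using h1, fun v => ?_⟩
  set w : EuclideanSpace ℂ a := WithLp.toLp 2 v with hw
  have hn : ∑ i, ‖v i‖ ^ 2 = ‖w‖ ^ 2 := (EuclideanSpace.norm_sq_eq w).symm
  rcases eq_or_ne w 0 with h0 | h0
  · have hv : v = 0 := by simpa [hw] using h0
    subst hv
    simp
  · have hpos : 0 < ‖w‖ := norm_pos_iff.2 h0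
    have h3 := h2 (a := (((‖w‖⁻¹ : ℝ) : ℂ) • w)) (by
      rw [mem_sphere_zero_iff_norm, norm_smul, Complex.norm_real, norm_inv, norm_norm,
        inv_mul_cancel₀ hpos.ne'])
    have h4 : ∑ j, ‖(star (((‖w‖⁻¹ : ℝ) : ℂ) • w).ofLp ᵥ* Ψ) j‖ ^ 2 =
        (‖w‖⁻¹) ^ 2 * ∑ j, ‖(star v ᵥ* Ψ) j‖ ^ 2 := by
      rw [Finset.mul_sum]
      refine Finset.sum_congr rfl fun j _ => ?_
      rw [WithLp.ofLp_smul, star_smul, smul_vecMul, Pi.smul_apply, norm_smul, mul_pow, norm_star,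
        Complex.norm_real, norm_inv, norm_norm]
    simp only [Set.mem_ofPred_eq] at h3
    rw [h4, inv_pow, inv_mul_le_iff₀ (by positivity)] at h3
    rw [hn, mul_comm]
    exact h3

/-- A matrix and its adjoint have the same operator norm: for `w = Ψy`, Cauchy–Schwarz on `‖w‖² =
⟨Ψ†w, y⟩` gives `‖w‖⁴ ≤ l‖w‖²‖y‖²`, and `‖w‖²` cancels. -/
theorem sum_norm_sq_mulVec_le_of_vecMul_le {Ψ : Matrix a b ℂ} {l : ℝ} (hl : 0 ≤ l)
    (h : ∀ v : a → ℂ, ∑ j, ‖(star v ᵥ* Ψ) j‖ ^ 2 ≤ l * ∑ i, ‖v i‖ ^ 2) (y : b → ℂ) :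
    ∑ i, ‖(Ψ *ᵥ y) i‖ ^ 2 ≤ l * ∑ j, ‖y j‖ ^ 2 := by
  set w := Ψ *ᵥ y with hw
  set N := ∑ i, ‖w i‖ ^ 2 with hN
  have h1 : (N : ℂ) = ∑ j, (star w ᵥ* Ψ) j * y j := by
    rw [hN, ← star_dotProduct_self]
    conv_lhs => rw [hw, dotProduct_mulVec, ← hw]
    rfl
  have h2 : N ≤ ∑ j, ‖(star w ᵥ* Ψ) j‖ * ‖y j‖ := by
    have := (Complex.re_le_norm (N : ℂ)).trans_eq (congrArg norm h1)
    rw [Complex.ofReal_re] at this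
    refine this.trans ((norm_sum_le _ _).trans_eq ?_)
    simp
  have h0 : 0 ≤ N := Finset.sum_nonneg fun _ _ => by positivity
  have hy : 0 ≤ ∑ j, ‖y j‖ ^ 2 := Finset.sum_nonneg fun _ _ => by positivity
  have h3 := (pow_le_pow_left₀ h0 h2 2).trans (Finset.sum_mul_sq_le_sq_mul_sq _ _ _)
  have h4 := h3.trans (mul_le_mul_of_nonneg_right (h w) hy)
  rcases h0.eq_or_lt with h5 | h5
  · rw [← h5]
    exact mul_nonneg hl hy
  · rw [← hN] at h4
    have : N * N ≤ N * (l * ∑ j, ‖y j‖ ^ 2) := by nlinarith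
    exact le_of_mul_le_mul_left this h5

/-- The partial transpose of `|ψ⟩⟨ψ|` is bounded by the square of the largest Schmidt
coefficient. -/
theorem posSemidef_smul_one_sub_partialTranspose_pure [DecidableEq a] [DecidableEq b]
    {Ψ : Matrix a b ℂ} {l : ℝ} (hl : 0 ≤ l)
    (h : ∀ v : a → ℂ, ∑ j, ‖(star v ᵥ* Ψ) j‖ ^ 2 ≤ l * ∑ i, ‖v i‖ ^ 2) :
    ((l : ℂ) • (1 : Matrix (a × b) (a × b) ℂ) -
      Matrix.of fun p q : a × b => Ψ q.1 p.2 * star (Ψ p.1 q.2)).PosSemidef := by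
  have hT : (Matrix.of fun p q : a × b => Ψ q.1 p.2 * star (Ψ p.1 q.2)).IsHermitian := by
    ext p q
    simp [mul_comm]
  have hM : ((l : ℂ) • (1 : Matrix (a × b) (a × b) ℂ) -
      Matrix.of fun p q : a × b => Ψ q.1 p.2 * star (Ψ p.1 q.2)).IsHermitian := by
    refine IsHermitian.sub ?_ hT
    rw [IsHermitian, conjTranspose_smul, conjTranspose_one]
    simp
  refine PosSemidef.of_dotProduct_mulVec_nonneg hM fun z => ?_
  refine Complex.nonneg_iff.2 ⟨?_, (hM.im_star_dotProduct_mulVec_self z).symm⟩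
  rw [sub_mulVec, smul_mulVec, one_mulVec, dotProduct_sub, dotProduct_smul, star_dotProduct_self,
    Complex.sub_re, smul_eq_mul, Complex.re_ofReal_mul, Complex.ofReal_re, sub_nonneg]
  -- Viewing `z` as a matrix `Z`, `G = ΨZ†` and the quadratic form is `∑ G i' i * conj (G i i')`. It
  -- is at most the squared Hilbert–Schmidt norm of `G`, which is at most `l‖z‖²` column by column.
  set G : a → a → ℂ := fun i' i => (Ψ *ᵥ fun j => star (z (i, j))) i' with hG
  have h1 : star z ⬝ᵥ (Matrix.of fun p q : a × b => Ψ q.1 p.2 * star (Ψ p.1 q.2)) *ᵥ z =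
      ∑ i, ∑ i', G i' i * star (G i i') := by
    simp only [hG, dotProduct, mulVec, Fintype.sum_prod_type, of_apply, star_sum, Pi.star_apply,
      star_mul', star_star, Finset.mul_sum, Finset.sum_mul]
    refine Finset.sum_congr rfl fun i _ => ?_
    rw [Finset.sum_comm]
    refine Finset.sum_congr rfl fun i' _ => ?_
    rw [Finset.sum_comm]
    refine Finset.sum_congr rfl fun j' _ => Finset.sum_congr rfl fun j _ => ?_
    ring
  have h2 : ∑ i, ∑ i', ‖G i' i‖ ^ 2 ≤ l * ∑ p, ‖z p‖ ^ 2 := by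
    rw [Fintype.sum_prod_type, Finset.mul_sum]
    refine Finset.sum_le_sum fun i _ => ?_
    have := sum_norm_sq_mulVec_le_of_vecMul_le hl h fun j => star (z (i, j))
    simp only [norm_star] at this
    exact this
  refine le_trans ?_ h2
  rw [h1]
  refine (Complex.re_le_norm _).trans ?_
  have h3 : ∑ i, ∑ i', ‖G i i'‖ ^ 2 = ∑ i, ∑ i', ‖G i' i‖ ^ 2 := Finset.sum_comm
  calc ‖∑ i, ∑ i', G i' i * star (G i i')‖ ≤ ∑ i, ∑ i', ‖G i' i‖ * ‖G i i'‖ := by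
        refine (norm_sum_le _ _).trans (Finset.sum_le_sum fun i _ =>
          (norm_sum_le _ _).trans_eq ?_)
        simp
    _ ≤ ∑ i, ∑ i', (‖G i' i‖ ^ 2 + ‖G i i'‖ ^ 2) / 2 := by
        refine Finset.sum_le_sum fun i _ => Finset.sum_le_sum fun i' _ => ?_
        linarith [two_mul_le_add_sq ‖G i' i‖ ‖G i i'‖]
    _ = ∑ i, ∑ i', ‖G i' i‖ ^ 2 := by
        simp only [← Finset.sum_div, Finset.sum_add_distrib]
        rw [h3]
        ring

/-- The fidelity of a pure state with a bipartite PPT state is bounded by the largest eigenvalue of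
the reduced state of the pure state. -/
theorem exists_re_star_dotProduct_mulVec_le_of_posSemidef [Nonempty a] (Ψ : Matrix a b ℂ)
    (σ : Matrix (a × b) (a × b) ℂ)
    (hσ : (Matrix.of fun p q : a × b => σ (q.1, p.2) (p.1, q.2)).PosSemidef) :
    ∃ u : EuclideanSpace ℂ a, ‖u‖ = 1 ∧
      (star (fun p : a × b => Ψ p.1 p.2) ⬝ᵥ σ *ᵥ (fun p : a × b => Ψ p.1 p.2)).re ≤
        (∑ j, ‖(star u.ofLp ᵥ* Ψ) j‖ ^ 2) * σ.trace.re := by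
  classical
  obtain ⟨u, hu, h⟩ := exists_unit_isMax_vecMul Ψ
  refine ⟨u, hu, ?_⟩
  have hl : 0 ≤ ∑ j, ‖(star u.ofLp ᵥ* Ψ) j‖ ^ 2 := Finset.sum_nonneg fun _ _ => by positivity
  have h1 := re_trace_mul_le hσ (posSemidef_smul_one_sub_partialTranspose_pure hl h)
  -- Transposing the first factor in both operators only relabels the summation indices.
  have h2 : ((Matrix.of fun p q : a × b => σ (q.1, p.2) (p.1, q.2)) *
      Matrix.of fun p q : a × b => Ψ q.1 p.2 * star (Ψ p.1 q.2)).trace =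
      star (fun p : a × b => Ψ p.1 p.2) ⬝ᵥ σ *ᵥ (fun p : a × b => Ψ p.1 p.2) := by
    simp only [Matrix.trace, diag_apply, Matrix.mul_apply, of_apply, dotProduct, mulVec,
      Fintype.sum_prod_type, Pi.star_apply, Finset.mul_sum]
    rw [Finset.sum_congr rfl fun i _ => Finset.sum_comm, Finset.sum_comm]
    refine Finset.sum_congr rfl fun i' _ => ?_
    rw [Finset.sum_comm]
    refine Finset.sum_congr rfl fun j _ => Finset.sum_congr rfl fun i _ =>
      Finset.sum_congr rfl fun j' _ => ?_
    ring
  -- The partial transpose has the diagonal of `σ`, so the two traces agree definitionally.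
  rw [h2] at h1
  exact h1

end Bipartite

/-! ### Local projections, the union bound, and splitting off one party. -/

section Tensor

variable {ι : Type*} [Fintype ι] [DecidableEq ι] {d : ι → ℕ}

/-- The tensor product of operators of the parties. -/
def tensorOp (U : ∀ i, Matrix (Fin (d i)) (Fin (d i)) ℂ) : Op d :=
  Matrix.of fun x y => ∏ i, U i (x i) (y i)

theorem tensorOp_mul (U V : ∀ i, Matrix (Fin (d i)) (Fin (d i)) ℂ) :
    tensorOp U * tensorOp V = tensorOp fun i => U i * V i := by
  ext x y
  simp only [tensorOp, Matrix.mul_apply, of_apply, ← Finset.prod_mul_distrib]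
  rw [Finset.prod_univ_sum, Fintype.piFinset_univ]

omit [DecidableEq ι] in
theorem conjTranspose_tensorOp (U : ∀ i, Matrix (Fin (d i)) (Fin (d i)) ℂ) :
    (tensorOp U)ᴴ = tensorOp fun i => (U i)ᴴ := by
  ext x y
  simp [tensorOp]

/-- The projection onto the local vectors `u i` of the parties in `S`. -/
def localProjection (S : Finset ι) (u : ∀ i, EuclideanSpace ℂ (Fin (d i))) : Op d :=
  tensorOp fun i => if i ∈ S then pureDensity (u i) else 1

theorem conjTranspose_localProjection (S : Finset ι) (u : ∀ i, EuclideanSpace ℂ (Fin (d i))) :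
    (localProjection S u)ᴴ = localProjection S u := by
  rw [localProjection, conjTranspose_tensorOp]
  congr 1
  ext1 i
  split_ifs
  · exact (posSemidef_vecMulVec_self_star (u i).ofLp).1
  · exact conjTranspose_one

theorem pureDensity_mul_self {n : Type*} [Fintype n] {ψ : EuclideanSpace ℂ n} (hψ : ‖ψ‖ = 1) :
    pureDensity ψ * pureDensity ψ = pureDensity ψ := by
  rw [pureDensity_eq_vecMulVec, vecMulVec_mul_vecMulVec, star_dotProduct_self,
    sum_norm_sq_eq_one hψ, Complex.ofReal_one, one_smul]

theorem localProjection_mul (S T : Finset ι) {u : ∀ i, EuclideanSpace ℂ (Fin (d i))}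
    (hu : ∀ i, ‖u i‖ = 1) :
    localProjection S u * localProjection T u = localProjection (S ∪ T) u := by
  rw [localProjection, localProjection, tensorOp_mul, localProjection]
  congr 1
  ext1 i
  by_cases h1 : i ∈ S <;> by_cases h2 : i ∈ T <;> simp [h1, h2, pureDensity_mul_self (hu i)]

theorem localProjection_empty (u : ∀ i, EuclideanSpace ℂ (Fin (d i))) :
    localProjection ∅ u = 1 := by
  ext x y
  simp [localProjection, tensorOp, Matrix.one_apply, Finset.prod_ite_zero, funext_iff]

theorem posSemidef_one_sub_mul_one_sub {n : Type*} [Fintype n] [DecidableEq n]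
    {P Q : Matrix n n ℂ} (hP : Pᴴ = P) (hP2 : P * P = P) (hQ : Qᴴ = Q) (hQ2 : Q * Q = Q)
    (h : Commute P Q) : ((1 - P) * (1 - Q)).PosSemidef := by
  obtain ⟨p1, p2⟩ := projection_one_sub hP hP2
  obtain ⟨q1, q2⟩ := projection_one_sub hQ hQ2
  have hc : Commute (1 - P) (1 - Q) :=
    ((Commute.one_left _).sub_left ((Commute.one_right _).sub_right h))
  refine posSemidef_of_projection ?_ ?_
  · rw [conjTranspose_mul, p1, q1, hc.eq]
  · rw [hc.symm.mul_mul_mul_comm, p2, q2]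

/-- Union bound for the commuting local projections. -/
theorem one_sub_localProjection_le_sum (S : Finset ι) {u : ∀ i, EuclideanSpace ℂ (Fin (d i))}
    (hu : ∀ i, ‖u i‖ = 1) {ψ : Space d} (hψ : ‖ψ‖ = 1) :
    1 - (star ψ.ofLp ⬝ᵥ localProjection S u *ᵥ ψ.ofLp).re ≤
      ∑ i ∈ S, (1 - (star ψ.ofLp ⬝ᵥ localProjection {i} u *ᵥ ψ.ofLp).re) := by
  have hself : star ψ.ofLp ⬝ᵥ ψ.ofLp = 1 := by
    rw [star_dotProduct_self, sum_norm_sq_eq_one hψ, Complex.ofReal_one]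
  induction S using Finset.induction_on with
  | empty => simp [localProjection_empty, hself]
  | insert i S hi ih =>
    have hc : Commute (localProjection {i} u) (localProjection S u) := by
      rw [Commute, SemiconjBy, localProjection_mul _ _ hu, localProjection_mul _ _ hu,
        Finset.union_comm]
    -- Expanding `(1-P)(1-Q) ≥ 0` gives `1 - PQ ≤ (1-P) + (1-Q)`.
    have h := re_star_dotProduct_mulVec_nonneg (posSemidef_one_sub_mul_one_sub
      (conjTranspose_localProjection {i} u)
      (by rw [localProjection_mul _ _ hu, Finset.union_self])
      (conjTranspose_localProjection S u)
      (by rw [localProjection_mul _ _ hu, Finset.union_self]) hc) ψ.ofLp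
    rw [mul_sub, mul_one, sub_mul, one_mul, localProjection_mul _ _ hu, ← Finset.insert_eq,
      sub_mulVec, sub_mulVec, sub_mulVec, one_mulVec, dotProduct_sub, dotProduct_sub,
      dotProduct_sub, hself, Complex.sub_re, Complex.sub_re, Complex.sub_re, Complex.one_re] at h
    rw [Finset.sum_insert hi]
    linarith

/-- The configuration with entry `k` at party `B` and `r` at the others. -/
abbrev joinAt (B : ι) (k : Fin (d B)) (r : Config fun i : {i // i ≠ B} => d i) : Config d :=
  (Equiv.piSplitAt B fun i => Fin (d i)).symm (k, r)

omit [Fintype ι] in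
@[simp] theorem joinAt_self (B : ι) (k : Fin (d B)) (r : Config fun i : {i // i ≠ B} => d i) :
    joinAt B k r B = k :=
  congrArg Prod.fst ((Equiv.piSplitAt B fun i => Fin (d i)).apply_symm_apply (k, r))

omit [Fintype ι] in
@[simp] theorem joinAt_ne (B : ι) (k : Fin (d B)) (r : Config fun i : {i // i ≠ B} => d i)
    (j : {i // i ≠ B}) : joinAt B k r j = r j :=
  congrFun (congrArg Prod.snd
    ((Equiv.piSplitAt B fun i => Fin (d i)).apply_symm_apply (k, r))) j

omit [Fintype ι] in
theorem joinAt_eta (B : ι) (x : Config d) : joinAt B (x B) (fun j => x j) = x :=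
  (Equiv.piSplitAt B fun i => Fin (d i)).symm_apply_apply x

theorem sum_config_eq (B : ι) {α : Type*} [AddCommMonoid α] (f : Config d → α) :
    ∑ x, f x = ∑ k, ∑ r, f (joinAt B k r) := by
  rw [← Fintype.sum_prod_type']
  exact (Equiv.sum_comp (Equiv.piSplitAt B fun i => Fin (d i)).symm f).symm

/-- The partial inner product `⟨w|ψ⟩`, a vector of party `B`, of `ψ` with a vector `w` of the other
parties. -/
noncomputable def partialInner (B : ι) (w : Space fun i : {i // i ≠ B} => d i) (ψ : Space d) :
    EuclideanSpace ℂ (Fin (d B)) :=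
  WithLp.toLp 2 fun k => ∑ r, star (w r) * ψ (joinAt B k r)

theorem star_dotProduct_partialTrace_mulVec (B : ι) (w : Space fun i : {i // i ≠ B} => d i)
    (ψ : Space d) :
    star w.ofLp ⬝ᵥ partialTrace B (pureDensity ψ) *ᵥ w.ofLp =
      ((‖partialInner B w ψ‖ ^ 2 : ℝ) : ℂ) := by
  rw [EuclideanSpace.norm_sq_eq, ← star_dotProduct_self]
  simp only [dotProduct, mulVec, partialTrace, pureDensity, of_apply, partialInner, Pi.star_apply,
    star_sum, star_mul', star_star, Finset.mul_sum, Finset.sum_mul, joinAt]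
  rw [Finset.sum_congr rfl fun r _ => Finset.sum_comm, Finset.sum_comm]
  refine Finset.sum_congr rfl fun k _ => Finset.sum_congr rfl fun r _ =>
    Finset.sum_congr rfl fun r' _ => ?_
  ring

theorem inner_productVector (B : ι) (φ : ∀ i, EuclideanSpace ℂ (Fin (d i))) (ψ : Space d) :
    inner ℂ (productVector φ) ψ =
      inner ℂ (φ B) (partialInner B (productVector fun j : {i // i ≠ B} => φ j) ψ) := by
  simp only [EuclideanSpace.inner_eq_star_dotProduct, dotProduct]
  rw [sum_config_eq B]
  refine Finset.sum_congr rfl fun k _ => ?_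
  simp only [partialInner, Finset.sum_mul]
  refine Finset.sum_congr rfl fun r _ => ?_
  simp only [productVector, Pi.star_apply]
  rw [Fintype.prod_eq_mul_prod_subtype_ne _ B]
  simp only [joinAt_self, joinAt_ne, star_mul']
  ring

theorem norm_productVector {φ : ∀ i, EuclideanSpace ℂ (Fin (d i))} (hφ : ∀ i, ‖φ i‖ = 1) :
    ‖productVector φ‖ = 1 := by
  have h : ‖productVector φ‖ ^ 2 = 1 := by
    rw [EuclideanSpace.norm_sq_eq]
    simp only [productVector, norm_prod, ← Finset.prod_pow]
    rw [← Fintype.piFinset_univ, ← Finset.prod_univ_sum (fun _ => Finset.univ)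
      fun i j => ‖φ i j‖ ^ 2]
    exact Finset.prod_eq_one fun i _ => sum_norm_sq_eq_one (hφ i)
  exact (pow_eq_one_iff_of_nonneg (norm_nonneg _) two_ne_zero).1 h

theorem IsProductState.norm_eq_one {φ : Space d} (hφ : IsProductState φ) : ‖φ‖ = 1 := by
  obtain ⟨v, hv, rfl⟩ := hφ
  exact norm_productVector hv

/-- A product vector of the parties other than `B` extends to a product state whose overlap with
`ψ` is the expectation in the reduced state. -/
theorem exists_isProductState_norm_inner_sq_eq (B : ι) {ψ : Space d} (hB : Nonempty (Fin (d B)))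
    {w : Space fun i : {i // i ≠ B} => d i} (hw : IsProductState w) :
    ∃ φ : Space d, IsProductState φ ∧ ‖inner ℂ φ ψ‖ ^ 2 =
      (star w.ofLp ⬝ᵥ partialTrace B (pureDensity ψ) *ᵥ w.ofLp).re := by
  obtain ⟨v, hv, rfl⟩ := hw
  rw [star_dotProduct_partialTrace_mulVec, Complex.ofReal_re]
  set χ := partialInner B (productVector v) ψ with hχ
  obtain ⟨k⟩ := hB
  -- The best vector of party `B` is the normalized contraction `χ`; if `χ = 0`, any unit vector
  -- serves.
  obtain ⟨z, hz, hz'⟩ : ∃ z : EuclideanSpace ℂ (Fin (d B)), ‖z‖ = 1 ∧ ‖inner ℂ z χ‖ = ‖χ‖ := by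
    rcases eq_or_ne χ 0 with h | h
    · exact ⟨EuclideanSpace.single k 1, by simp, by simp [h]⟩
    · have hpos := norm_pos_iff.2 h
      refine ⟨((‖χ‖⁻¹ : ℝ) : ℂ) • χ, ?_, ?_⟩
      · rw [norm_smul, Complex.norm_real, norm_inv, norm_norm, inv_mul_cancel₀ hpos.ne']
      · rw [inner_smul_left, norm_mul, inner_self_eq_norm_sq_to_K]
        simp
        field_simp
  set u := (Equiv.piSplitAt B fun i => EuclideanSpace ℂ (Fin (d i))).symm (z, v) with hu
  have hsplit := (Equiv.piSplitAt B fun i => EuclideanSpace ℂ (Fin (d i))).apply_symm_apply (z, v)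
  have huB : u B = z := congrArg Prod.fst hsplit
  have huv : (fun j : {i // i ≠ B} => u j) = v := congrArg Prod.snd hsplit
  refine ⟨productVector u, ⟨u, fun i => ?_, rfl⟩, ?_⟩
  · by_cases h : i = B
    · rw [h, huB, hz]
    · rw [congrFun huv ⟨i, h⟩, hv]
  · rw [inner_productVector B, huB, huv, hz']

/-- Cauchy–Schwarz at party `B`: no choice of the vector there beats the one aligned with the
contraction. -/
theorem norm_inner_productVector_sq_le (B : ι) {ψ : Space d}
    {φ : ∀ i, EuclideanSpace ℂ (Fin (d i))} (hφ : ∀ i, ‖φ i‖ = 1) :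
    ‖inner ℂ (productVector φ) ψ‖ ^ 2 ≤
      (star (productVector fun j : {i // i ≠ B} => φ j).ofLp ⬝ᵥ
        partialTrace B (pureDensity ψ) *ᵥ
          (productVector fun j : {i // i ≠ B} => φ j).ofLp).re := by
  rw [star_dotProduct_partialTrace_mulVec, Complex.ofReal_re, inner_productVector B]
  refine pow_le_pow_left₀ (norm_nonneg _) ((norm_inner_le_norm _ _).trans_eq ?_) 2
  rw [hφ, one_mul]

omit [Fintype ι] in
theorem piecewise_joinAt (B : ι) (k k' : Fin (d B))
    (r r' : Config fun i : {i // i ≠ B} => d i) :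
    ({B} : Finset ι).piecewise (joinAt B k r) (joinAt B k' r') = joinAt B k r' := by
  rw [← joinAt_eta B (({B} : Finset ι).piecewise (joinAt B k r) (joinAt B k' r'))]
  congr 2
  · rw [Finset.piecewise_eq_of_mem _ _ _ (Finset.mem_singleton_self B), joinAt_self]
  · ext1 j
    rw [Finset.piecewise_eq_of_notMem _ _ _ (by simpa using j.2), joinAt_ne]

/-- The expectation of the projection onto a vector of party `i`. -/
theorem star_dotProduct_localProjection_singleton_mulVec (i : ι)
    (u : ∀ i, EuclideanSpace ℂ (Fin (d i))) (ψ : Space d) :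
    (star ψ.ofLp ⬝ᵥ localProjection {i} u *ᵥ ψ.ofLp).re =
      ∑ r, ‖(star (u i).ofLp ᵥ* Matrix.of fun k r => ψ (joinAt i k r)) r‖ ^ 2 := by
  have hP : ∀ k r k' r', localProjection {i} u (joinAt i k r) (joinAt i k' r') =
      if r = r' then u i k * star (u i k') else 0 := by
    intro k r k' r'
    simp only [localProjection, tensorOp, of_apply]
    rw [Fintype.prod_eq_mul_prod_subtype_ne _ i]
    have : ∀ j : {j // j ≠ i}, (if (j : ι) ∈ ({i} : Finset ι) then pureDensity (u j) else 1)
        (joinAt i k r j) (joinAt i k' r' j) = if r j = r' j then (1 : ℂ) else 0 := by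
      intro j
      rw [if_neg (by simpa using j.2), joinAt_ne, joinAt_ne, Matrix.one_apply]
    rw [Finset.prod_congr rfl fun j _ => this j, Finset.prod_ite_zero]
    simp [pureDensity, funext_iff]
  rw [← Complex.ofReal_re (∑ r, _), ← star_dotProduct_self]
  congr 1
  simp only [dotProduct, mulVec, vecMul, sum_config_eq i, hP, of_apply, Pi.star_apply, star_sum,
    star_mul', star_star, Finset.mul_sum, Finset.sum_mul, ite_mul, zero_mul, mul_ite, mul_zero,
    Finset.sum_ite_eq, Finset.mem_univ, if_true]
  refine Finset.sum_comm.trans (Finset.sum_congr rfl fun r _ => Finset.sum_comm.trans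
    (Finset.sum_congr rfl fun k _ => Finset.sum_congr rfl fun k' _ => ?_))
  ring

/-- Links the union bound, which concerns the projection on all parties but `B`, to the overlap
attainable by a suitable vector at `B`. -/
theorem star_dotProduct_localProjection_erase_mulVec (B : ι)
    (u : ∀ i, EuclideanSpace ℂ (Fin (d i))) (ψ : Space d) :
    star ψ.ofLp ⬝ᵥ localProjection (Finset.univ.erase B) u *ᵥ ψ.ofLp =
      ((‖partialInner B (productVector fun j : {i // i ≠ B} => u j) ψ‖ ^ 2 : ℝ) : ℂ) := by
  have hP : ∀ k r k' r', localProjection (Finset.univ.erase B) u (joinAt B k r) (joinAt B k' r') =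
      if k = k' then (productVector fun j : {i // i ≠ B} => u j) r *
        star ((productVector fun j : {i // i ≠ B} => u j) r') else 0 := by
    intro k r k' r'
    simp only [localProjection, tensorOp, of_apply]
    rw [Fintype.prod_eq_mul_prod_subtype_ne _ B]
    have : ∀ j : {j // j ≠ B}, (if (j : ι) ∈ Finset.univ.erase B then pureDensity (u j) else 1)
        (joinAt B k r j) (joinAt B k' r' j) = u j (r j) * star (u j (r' j)) := by
      intro j
      rw [if_pos (by simpa using j.2), joinAt_ne, joinAt_ne]
      rfl
    rw [Finset.prod_congr rfl fun j _ => this j, Finset.prod_mul_distrib]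
    simp [productVector, Matrix.one_apply]
  rw [EuclideanSpace.norm_sq_eq, ← star_dotProduct_self]
  simp only [dotProduct, mulVec, sum_config_eq B, hP, Pi.star_apply, star_sum, partialInner,
    star_mul', star_star, Finset.mul_sum, Finset.sum_mul, ite_mul, zero_mul, mul_ite, mul_zero,
    Finset.sum_ite_irrel, Finset.sum_const_zero, Finset.sum_ite_eq, Finset.mem_univ, if_true]
  refine Finset.sum_congr rfl fun k _ => Finset.sum_comm.trans
    (Finset.sum_congr rfl fun r _ => Finset.sum_congr rfl fun r' _ => ?_)
  ring

end Tensor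

/-! ### From PPT states to product states, and bounds on the geometric entanglement. -/

section PPT

variable {ι : Type*} [Fintype ι] [DecidableEq ι] {d : ι → ℕ}

/-- The bipartite bound on the cut `{i} | rest`; the second party `j` makes this a genuine
bipartition. -/
theorem IsPPT.exists_unit_re_le {σ : Op d} (hσ : IsPPT σ) (ψ : Space d) {i j : ι} (hij : j ≠ i)
    (hi : Nonempty (Fin (d i))) :
    ∃ u : EuclideanSpace ℂ (Fin (d i)), ‖u‖ = 1 ∧ (star ψ.ofLp ⬝ᵥ σ *ᵥ ψ.ofLp).re ≤
      ∑ r, ‖(star u.ofLp ᵥ* Matrix.of fun k r => ψ (joinAt i k r)) r‖ ^ 2 := by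
  have h := (hσ.2 {i} (Finset.singleton_nonempty i) ⟨j, by simpa using hij⟩).submatrix
    (Equiv.piSplitAt i fun i => Fin (d i)).symm
  obtain ⟨u, hu, hle⟩ := exists_re_star_dotProduct_mulVec_le_of_posSemidef
    (Matrix.of fun k r => ψ (joinAt i k r))
    (σ.submatrix (fun p => joinAt i p.1 p.2) fun p => joinAt i p.1 p.2) (by
      convert h using 1
      ext p q
      simp only [of_apply, submatrix_apply, partialTranspose]
      rw [piecewise_joinAt i q.1 p.1 q.2 p.2, piecewise_joinAt i p.1 q.1 p.2 q.2])
  refine ⟨u, hu, ?_⟩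
  have h1 : (σ.submatrix (fun p : Fin (d i) × _ => joinAt i p.1 p.2)
      fun p => joinAt i p.1 p.2).trace = 1 := by
    rw [← hσ.1.2, Matrix.trace, Matrix.trace, sum_config_eq i, Fintype.sum_prod_type]
    rfl
  rw [h1, Complex.one_re, mul_one] at hle
  refine le_trans (le_of_eq ?_) hle
  simp only [dotProduct, mulVec, sum_config_eq i, Fintype.sum_prod_type, of_apply,
    submatrix_apply, Pi.star_apply]

theorem nonempty_config_of_norm_eq_one {ψ : Space d} (hψ : ‖ψ‖ = 1) : Nonempty (Config d) := by
  by_contra h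
  rw [not_nonempty_iff] at h
  rw [Subsingleton.elim ψ 0, norm_zero] at hψ
  exact zero_ne_one hψ

/-- A pure state close to a PPT state has a large overlap with a product state. -/
theorem IsPPT.exists_isProductState_overlap {σ : Op d} (hσ : IsPPT σ)
    (hι : 2 ≤ Fintype.card ι) {ψ : Space d} (hψ : ‖ψ‖ = 1) :
    ∃ φ : Space d, IsProductState φ ∧ 1 - ‖inner ℂ φ ψ‖ ^ 2 ≤
      ((Fintype.card ι : ℝ) - 1) * (1 - (star ψ.ofLp ⬝ᵥ σ *ᵥ ψ.ofLp).re) := by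
  have hnt : Nontrivial ι := Fintype.one_lt_card_iff_nontrivial.1 hι
  obtain ⟨x⟩ := nonempty_config_of_norm_eq_one hψ
  have hex : ∀ i, ∃ u : EuclideanSpace ℂ (Fin (d i)), ‖u‖ = 1 ∧
      (star ψ.ofLp ⬝ᵥ σ *ᵥ ψ.ofLp).re ≤
        ∑ r, ‖(star u.ofLp ᵥ* Matrix.of fun k r => ψ (joinAt i k r)) r‖ ^ 2 := by
    intro i
    obtain ⟨j, hj⟩ := exists_ne i
    exact hσ.exists_unit_re_le ψ hj ⟨x i⟩
  choose u hu hle using hex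
  -- The vector found for `B` is discarded and replaced by the optimal one, so only `M - 1` parties
  -- enter the union bound.
  obtain ⟨B⟩ := hnt.to_nonempty
  obtain ⟨φ, hφ, h⟩ := exists_isProductState_norm_inner_sq_eq B (ψ := ψ) ⟨x B⟩
    (w := productVector fun j : {i // i ≠ B} => u j) ⟨_, fun j => hu j, rfl⟩
  refine ⟨φ, hφ, ?_⟩
  rw [h, star_dotProduct_partialTrace_mulVec, ← star_dotProduct_localProjection_erase_mulVec]
  refine (one_sub_localProjection_le_sum _ hu hψ).trans ?_
  refine (Finset.sum_le_card_nsmul _ _ (1 - (star ψ.ofLp ⬝ᵥ σ *ᵥ ψ.ofLp).re) fun i _ => ?_).trans ?_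
  · rw [star_dotProduct_localProjection_singleton_mulVec]
    exact sub_le_sub_left (hle i) 1
  · rw [Finset.card_erase_of_mem (Finset.mem_univ B), Finset.card_univ, nsmul_eq_mul,
      Nat.cast_pred (by omega)]

theorem re_star_dotProduct_pureDensity_mulVec {n : Type*} [Fintype n] (φ ψ : EuclideanSpace ℂ n) :
    (star ψ.ofLp ⬝ᵥ pureDensity φ *ᵥ ψ.ofLp).re = ‖inner ℂ φ ψ‖ ^ 2 := by
  have h : star ψ.ofLp ⬝ᵥ pureDensity φ *ᵥ ψ.ofLp = inner ℂ ψ φ * inner ℂ φ ψ := by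
    rw [pureDensity_eq_vecMulVec, vecMulVec_mulVec, EuclideanSpace.inner_eq_star_dotProduct,
      EuclideanSpace.inner_eq_star_dotProduct]
    simp [dotProduct_comm, mul_comm]
  rw [h, ← inner_conj_symm, Complex.conj_mul', ← Complex.ofReal_pow, Complex.ofReal_re]

theorem IsPPT.exists_isProductState_traceNorm_le {σ : Op d} (hσ : IsPPT σ)
    (hι : 2 ≤ Fintype.card ι) {ψ : Space d} (hψ : ‖ψ‖ = 1) {ε : ℝ}
    (hF : fidelity (pureDensity ψ) σ = 1 - ε) :
    ∃ φ : Space d, IsProductState φ ∧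
      traceNorm (pureDensity φ - pureDensity ψ) ≤ (4 * (Fintype.card ι : ℝ) - 6) * √ε ∧
      traceNorm (σ - pureDensity φ) ≤ 4 * ((Fintype.card ι : ℝ) - 1) * √ε ∧
      ∀ ρ : Op d, IsState ρ →
        ‖(ρ * σ).trace - (ρ * pureDensity φ).trace‖ ≤ 4 * ((Fintype.card ι : ℝ) - 1) * √ε := by
  obtain ⟨φ, hφ, h⟩ := hσ.exists_isProductState_overlap hι hψ
  rw [fidelity_pureDensity hσ.1.1 hψ] at hF
  rw [hF, sub_sub_cancel] at h
  have hι' : (2 : ℝ) ≤ Fintype.card ι := by exact_mod_cast hι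
  set N : ℝ := (Fintype.card ι : ℝ)
  have hφs := isState_pureDensity hφ.norm_eq_one
  have hψs := isState_pureDensity hψ
  have h1 : traceNorm (pureDensity φ - pureDensity ψ) ≤ (4 * N - 6) * √ε := by
    refine (traceNorm_sub_pureDensity_le hφs hψ).trans ?_
    rw [re_star_dotProduct_pureDensity_mulVec]
    -- `(2N-3)² - (N-1) = (4N-5)(N-2) ≥ 0`, with equality at `N = 2`. The linear constant `4N - 6`
    -- thus weakens the bound `2√(N-1)`.
    have h2 : √(N - 1) ≤ 2 * N - 3 := by
      rw [Real.sqrt_le_left (by linarith)]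
      nlinarith
    calc 2 * √(1 - ‖inner ℂ φ ψ‖ ^ 2) ≤ 2 * √((N - 1) * ε) :=
          mul_le_mul_of_nonneg_left (Real.sqrt_le_sqrt h) zero_le_two
      _ = 2 * (√(N - 1) * √ε) := by rw [Real.sqrt_mul (by linarith)]
      _ ≤ 2 * ((2 * N - 3) * √ε) := mul_le_mul_of_nonneg_left
          (mul_le_mul_of_nonneg_right h2 (Real.sqrt_nonneg _)) zero_le_two
      _ = (4 * N - 6) * √ε := by ring
  have h3 : traceNorm (σ - pureDensity ψ) ≤ 2 * √ε := by
    have := traceNorm_sub_pureDensity_le hσ.1 hψ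
    rwa [hF, sub_sub_cancel] at this
  have hneg : traceNorm (pureDensity ψ - pureDensity φ) =
      traceNorm (pureDensity φ - pureDensity ψ) := by
    rw [← neg_sub, traceNorm, traceNorm, conjTranspose_neg, neg_mul_neg]
  have h4 : traceNorm (σ - pureDensity φ) ≤ 4 * (N - 1) * √ε := by
    -- Triangle inequality through `ψ`: `2 + (4N - 6) = 4(N - 1)`.
    have := traceNorm_add_le (hσ.1.1.1.sub hψs.1.1) (hψs.1.1.sub hφs.1.1)
    rw [sub_add_sub_cancel, hneg] at this
    linarith
  refine ⟨φ, hφ, h1, h4, fun ρ hρ => ?_⟩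
  rw [← trace_sub, ← mul_sub]
  exact (hρ.norm_trace_mul_le_traceNorm (hσ.1.1.1.sub hφs.1.1)).trans h4

/-- Transposing a local rank-one projection conjugates its vector, so the partial transpose is again
of the form `|w⟩⟨w|` with `w` a product vector. -/
theorem IsProductState.isPPT_pureDensity {φ : Space d} (hφ : IsProductState φ) :
    IsPPT (pureDensity φ) := by
  refine ⟨isState_pureDensity hφ.norm_eq_one, fun S _ _ => ?_⟩
  obtain ⟨v, -, rfl⟩ := hφ
  set w : Space d := productVector fun i => if i ∈ S then WithLp.toLp 2 (star (v i).ofLp) else v i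
    with hw
  have : partialTranspose S (pureDensity (productVector v)) = pureDensity w := by
    ext x y
    simp only [partialTranspose, pureDensity, productVector, of_apply, hw, star_prod,
      ← Finset.prod_mul_distrib]
    refine Finset.prod_congr rfl fun i _ => ?_
    by_cases hi : i ∈ S <;> simp [hi, mul_comm]
  rw [this]
  exact posSemidef_vecMulVec_self_star _

omit [DecidableEq ι] in
theorem IsProductState.isFullySeparable {φ : Space d} (hφ : IsProductState φ) :
    IsFullySeparable (pureDensity φ) :=
  subset_convexHull ℝ _ ⟨φ, hφ, rfl⟩

theorem isProductState_of_unique [Unique ι] {ψ : Space d} (hψ : ‖ψ‖ = 1) : IsProductState ψ := by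
  have h : ∀ x : Config d, uniqueElim (x default) = x :=
    (Equiv.piUnique fun i => Fin (d i)).symm_apply_apply
  refine ⟨uniqueElim (WithLp.toLp 2 fun a : Fin (d default) => ψ (uniqueElim a)), fun i => ?_, ?_⟩
  · rw [Unique.eq_default i, uniqueElim_default, ← hψ, EuclideanSpace.norm_eq,
      EuclideanSpace.norm_eq]
    congr 1
    exact Equiv.sum_comp (Equiv.piUnique fun i => Fin (d i)).symm fun x => ‖ψ x‖ ^ 2
  · ext x
    simp only [productVector, Fintype.prod_unique, uniqueElim_default, h]

/-- The largest eigenvalue of a positive semidefinite matrix bounds its expectations. -/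
theorem exists_unit_re_trace_mul_le {n : Type*} [Fintype n] [Nonempty n]
    {X σ : Matrix n n ℂ} (hX : X.PosSemidef) (hσ : IsState σ) :
    ∃ u : EuclideanSpace ℂ n, ‖u‖ = 1 ∧ (X * σ).trace.re ≤ (star u.ofLp ⬝ᵥ X *ᵥ u.ofLp).re := by
  classical
  obtain ⟨C, rfl⟩ := exists_conjTranspose_mul_self hX
  -- With `X = C†C`, the norm of `u†C†` is that of `Cu`, so the maximizer is a top eigenvector of
  -- `X`.
  obtain ⟨u, hu, h⟩ := exists_unit_isMax_vecMul Cᴴ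
  refine ⟨u, hu, ?_⟩
  have hq : ∀ v : n → ℂ, star v ⬝ᵥ (Cᴴ * C) *ᵥ v = ((∑ j, ‖(star v ᵥ* Cᴴ) j‖ ^ 2 : ℝ) : ℂ) := by
    intro v
    rw [star_dotProduct_conjTranspose_mul_mulVec, ← star_mulVec]
    simp
  have hle := re_trace_mul_le hσ.1 (Y := Cᴴ * C) (c := ∑ j, ‖(star u.ofLp ᵥ* Cᴴ) j‖ ^ 2) ?_
  · rwa [hσ.2, Complex.one_re, mul_one, trace_mul_comm, ← Complex.ofReal_re (∑ j, _), ← hq] at hle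
  · have hM : (((∑ j, ‖(star u.ofLp ᵥ* Cᴴ) j‖ ^ 2 : ℝ) : ℂ) • (1 : Matrix n n ℂ) -
        Cᴴ * C).IsHermitian := by
      refine IsHermitian.sub ?_ hX.1
      rw [IsHermitian, conjTranspose_smul, conjTranspose_one, Complex.star_def,
        Complex.conj_ofReal]
    refine PosSemidef.of_dotProduct_mulVec_nonneg hM fun z => ?_
    rw [sub_mulVec, smul_mulVec, one_mulVec, dotProduct_sub, dotProduct_smul,
      star_dotProduct_self, hq, smul_eq_mul, ← Complex.ofReal_mul, ← Complex.ofReal_sub]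
    exact Complex.zero_le_real.2 (sub_nonneg.2 (h z))

theorem isState_partialTrace (B : ι) {ψ : Space d} (hψ : ‖ψ‖ = 1) :
    IsState (partialTrace B (pureDensity ψ)) := by
  obtain ⟨h1, h2⟩ := isState_pureDensity hψ
  constructor
  · have : partialTrace B (pureDensity ψ) =
        ∑ k, (pureDensity ψ).submatrix (joinAt B k) (joinAt B k) := by
      ext x y
      simp [partialTrace, Matrix.sum_apply]
    rw [this]
    exact posSemidef_sum _ fun k _ => h1.submatrix _
  · rw [← h2, Matrix.trace, Matrix.trace, sum_config_eq B, Finset.sum_comm]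
    rfl

theorem geometricEntanglement_le {ψ : Space d} (hψ : ‖ψ‖ = 1) {φ : Space d}
    (hφ : IsProductState φ) : geometricEntanglement ψ ≤ 1 - ‖inner ℂ φ ψ‖ ^ 2 := by
  suffices hb : BddAbove {r : ℝ | ∃ φ : Space d, IsProductState φ ∧ r = ‖inner ℂ φ ψ‖ ^ 2} from
    sub_le_sub_left (le_csSup hb ⟨φ, hφ, rfl⟩) 1
  refine ⟨1, ?_⟩
  rintro r ⟨χ, hχ, rfl⟩
  refine pow_le_one₀ (norm_nonneg _) ((norm_inner_le_norm _ _).trans_eq ?_)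
  rw [hχ.norm_eq_one, hψ, one_mul]

theorem IsOptimalPPT.pptEstimate_eq {B : ι} {Ψ : Space d}
    {σ : Op (fun i : {i // i ≠ B} => d i)} (hσ : IsOptimalPPT B Ψ σ) :
    pptEstimate B Ψ = 1 - (partialTrace B (pureDensity Ψ) * σ).trace.re := by
  rw [pptEstimate, IsGreatest.csSup_eq (a := (partialTrace B (pureDensity Ψ) * σ).trace.re)]
  refine ⟨⟨σ, hσ.1, rfl⟩, ?_⟩
  rintro r ⟨τ, hτ, rfl⟩
  exact hσ.2 τ hτ

/-- Dropping party `B` from an optimal product state for `Ψ` leaves a PPT competitor whose value is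
at least the squared overlap. -/
theorem IsOptimalPPT.pptEstimate_le_geometricEntanglement {B : ι} {Ψ : Space d} (hΨ : ‖Ψ‖ = 1)
    {σ : Op (fun i : {i // i ≠ B} => d i)} (hσ : IsOptimalPPT B Ψ σ) :
    pptEstimate B Ψ ≤ geometricEntanglement Ψ := by
  obtain ⟨φ, ⟨v, hv, rfl⟩, h⟩ := exists_geometricEntanglement_eq Ψ
    (norm_ne_zero_iff.1 (hΨ.trans_ne one_ne_zero))
  have hw : IsProductState (productVector fun j : {i // i ≠ B} => v j) :=
    ⟨_, fun j => hv j, rfl⟩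
  have h1 := hσ.2 _ hw.isPPT_pureDensity
  rw [trace_mul_pureDensity] at h1
  rw [h, hσ.pptEstimate_eq]
  exact sub_le_sub_left ((norm_inner_productVector_sq_le B hv).trans h1) 1

theorem geometricEntanglement_le_one_sub_partialTrace {B : ι} {Ψ : Space d} (hΨ : ‖Ψ‖ = 1)
    {w : Space fun i : {i // i ≠ B} => d i} (hw : IsProductState w) :
    geometricEntanglement Ψ ≤
      1 - (star w.ofLp ⬝ᵥ partialTrace B (pureDensity Ψ) *ᵥ w.ofLp).re := by
  obtain ⟨x⟩ := nonempty_config_of_norm_eq_one hΨ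
  obtain ⟨φ, hφ, h⟩ := exists_isProductState_norm_inner_sq_eq B (ψ := Ψ) ⟨x B⟩ hw
  rw [← h]
  exact geometricEntanglement_le hΨ hφ

theorem IsOptimalPPT.geometricEntanglement_le_pptEstimate_add {B : ι} {Ψ : Space d}
    (hΨ : ‖Ψ‖ = 1) (hι : 2 ≤ Fintype.card ι) {σ : Op (fun i : {i // i ≠ B} => d i)}
    (hσ : IsOptimalPPT B Ψ σ) {ψ : Space (fun i : {i // i ≠ B} => d i)} (hψ : ‖ψ‖ = 1) {ε : ℝ}
    (hF : fidelity (pureDensity ψ) σ = 1 - ε) :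
    geometricEntanglement Ψ ≤ pptEstimate B Ψ + 4 * ((Fintype.card ι : ℝ) - 2) * √ε := by
  have hρ := isState_partialTrace B hΨ
  have hcard : Fintype.card {i // i ≠ B} = Fintype.card ι - 1 := by
    rw [Fintype.card_subtype_compl, Fintype.card_subtype_eq]
  rw [hσ.pptEstimate_eq]
  -- With two parties the error term vanishes and part (1) does not apply to the one remaining
  -- party. There every pure state is a product state, so a maximizer of the form of `ρ` gives the
  -- bound directly.
  rcases hι.eq_or_lt with h2 | h2
  · have : Nonempty (Config fun i : {i // i ≠ B} => d i) := nonempty_config_of_norm_eq_one hψ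
    obtain ⟨hU⟩ := Fintype.card_eq_one_iff_nonempty_unique.1
      (show Fintype.card {i // i ≠ B} = 1 by omega)
    let _ : Unique {i // i ≠ B} := hU
    obtain ⟨u, hu, hle⟩ := exists_unit_re_trace_mul_le hρ.1 hσ.1.1
    have := geometricEntanglement_le_one_sub_partialTrace hΨ (isProductState_of_unique hu)
    rw [← h2]
    norm_num
    linarith
  -- Part (1) for the `M - 1` remaining parties, whence the constant `4((M-1) - 1) = 4(M-2)`.
  · obtain ⟨φ, hφ, -, -, h⟩ := hσ.1.exists_isProductState_traceNorm_le (by omega) hψ hF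
    have h1 := geometricEntanglement_le_one_sub_partialTrace hΨ hφ
    have h3 := (Complex.re_le_norm _).trans (h _ hρ)
    rw [trace_mul_pureDensity, Complex.sub_re, hcard, Nat.cast_pred (by omega)] at h3
    linarith

end PPT

end Multipartite

theorem mainTheorem3 (M : ℕ) (hM : 2 ≤ M) (d : Fin M → ℕ) :
    (∀ (ψ : Space d) (σ : Op d) (ε : ℝ), ‖ψ‖ = 1 → IsPPT σ →
      fidelity (pureDensity ψ) σ = 1 - ε →
        ∃ σSEP : Op d, IsFullySeparable σSEP ∧
          (∃ φ : Space d, IsProductState φ ∧ σSEP = pureDensity φ) ∧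
          traceNorm (σSEP - pureDensity ψ) ≤ (4 * (M : ℝ) - 6) * √ε ∧
          traceNorm (σ - σSEP) ≤ 4 * ((M : ℝ) - 1) * √ε ∧
          ∀ ρ : Op d, IsState ρ →
            ‖(ρ * σ).trace - (ρ * σSEP).trace‖ ≤ 4 * ((M : ℝ) - 1) * √ε) ∧
    (∀ (B : Fin M) (Ψ : Space d) (σ : Op (fun i : {i // i ≠ B} => d i))
      (ψ : Space (fun i : {i // i ≠ B} => d i)) (ε : ℝ),
      ‖Ψ‖ = 1 → ‖ψ‖ = 1 → IsOptimalPPT B Ψ σ → fidelity (pureDensity ψ) σ = 1 - ε →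
        pptEstimate B Ψ ≤ geometricEntanglement Ψ ∧
        geometricEntanglement Ψ ≤ pptEstimate B Ψ + 4 * ((M : ℝ) - 2) * √ε) := by
  have hcard : Fintype.card (Fin M) = M := Fintype.card_fin M
  refine ⟨fun ψ σ ε hψ hσ hF => ?_, fun B Ψ σ ψ ε hΨ hψ hσ hF => ⟨?_, ?_⟩⟩
  · obtain ⟨φ, hφ, h1, h2, h3⟩ := hσ.exists_isProductState_traceNorm_le (by omega) hψ hF
    rw [hcard] at h1 h2 h3
    exact ⟨pureDensity φ, hφ.isFullySeparable, ⟨φ, hφ, rfl⟩, h1, h2, h3⟩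
  · exact hσ.pptEstimate_le_geometricEntanglement hΨ
  · have h := hσ.geometricEntanglement_le_pptEstimate_add hΨ (by omega) hψ hF
    rwa [hcard] at h
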